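/- Fix $\varepsilon>0$. On $M=\mathbb{R}^3_{x,y,z}$ (the Heisenberg group) consider the left-invariant frame $X_1=\partial_x-\frac y2\partial_z$, $X_2=\partial_y+\frac x2\partial_z$, $X_3=\partial_z$, the Hamiltonians $h_i(p)=\langle p,X_i\rangle$ on $T^*M$, and the Lorentzian structure with orthonormal frame $X_1,X_2,\varepsilon X_3$ ($X_1$ timelike and future directed). Its arclength parametrized normal extremals are the trajectories, lying on $\{H=-\frac12\}$, of the Hamiltonian vector field of $H=\frac12(-h_1^2+h_2^2+\varepsilon^2h_3^2)$, i.e. the solutions on that level surface of $$\dot h_1=-h_2h_3,\quad \dot h_2=-h_1h_3,\quad \dot h_3=0,\qquad \dot x=-h_1,\quad \dot y=h_2,\quad \dot z=h_1\frac y2+h_2\frac x2+\varepsilon^2h_3 .$$ Let $\mathrm{Exp}(\theta,\varphi,t)=(x(t),y(t),z(t))$ for the unique such extremal with $(x,y,z)(0)=(0,0,0)$ and $h_1(0)=-\cosh\theta$, $h_2(0)=\sinh\theta\cos\varphi$, $\varepsilon h_3(0)=\sinh\theta\sin\varphi$. Where $h_3\ne0$, use $\tau=h_3t$ (with $h_3=\sinh\theta\sin\varphi/\varepsilon$)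 in place of $t$ as the third coordinate, and regard $\mathrm{Exp}$ as a function of $(\theta,\varphi,\tau)$. Put $$N=\{(\theta,\varphi,\tau)\in\mathbb{R}^3 \mid \theta>0,\ \varphi\in(0,\pi),\ \tau>0\},$$ $$D_+=\Big\{(x,y,z)\in M \;\Big|\; x>|y|,\ 0<z<\frac{\varepsilon^2}{2}(\sinh T+T),\ T=\operatorname{arcosh}\Big(\frac{x^2-y^2}{2\varepsilon^2}+1\Big)\Big\}.$$ Then (1) $\mathrm{Exp}(N)\subset D_+$; (2) $N$ and $D_+$ are open subsets of $\mathbb{R}^3$, and $\mathrm{Exp}\colon N\to D_+$ is a ($C^\infty$) diffeomorphism. -/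

import Mathlib

open Set
open scoped ContDiff

noncomputable section

namespace HeisenbergLorentz

/-- The Heisenberg group `M`, with its coordinates `(x, y, z)`. -/
abbrev M : Type := ℝ × ℝ × ℝ

/-- The cotangent bundle of `M`, trivialised by the left-invariant frame
`X₁ = ∂x - (y/2) ∂z`, `X₂ = ∂y + (x/2) ∂z`, `X₃ = ∂z`: a covector `p` at `q` is recorded as
`((h₁, h₂, h₃), q)` with `hᵢ = ⟨p, Xᵢ(q)⟩`. -/
abbrev Cotangent : Type := (ℝ × ℝ × ℝ) × M

/-- The Hamiltonian `H = (-h₁² + h₂² + ε² h₃²) / 2`. -/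
def hamiltonian (ε : ℝ) : Cotangent → ℝ :=
  fun ⟨⟨h₁, h₂, h₃⟩, _⟩ => (-h₁ ^ 2 + h₂ ^ 2 + ε ^ 2 * h₃ ^ 2) / 2

/-- The Hamiltonian vector field of `H` in the coordinates `((h₁, h₂, h₃), (x, y, z))`:
`ḣ₁ = -h₂ h₃`, `ḣ₂ = -h₁ h₃`, `ḣ₃ = 0` (as `[X₁, X₂] = X₃` is the only non-zero bracket) and
`q̇ = -h₁ X₁(q) + h₂ X₂(q) + ε² h₃ X₃(q)`. -/
def hamiltonianField (ε : ℝ) : Cotangent → Cotangent :=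
  fun ⟨⟨h₁, h₂, h₃⟩, ⟨x, y, _⟩⟩ =>
    ⟨⟨-(h₂ * h₃), -(h₁ * h₃), 0⟩, ⟨-h₁, h₂, h₁ * (y / 2) + h₂ * (x / 2) + ε ^ 2 * h₃⟩⟩

/-- Arclength parametrised normal extremals: the trajectories of the Hamiltonian vector field
that lie on the level surface `H = -1/2`. -/
structure IsNormalExtremal (ε : ℝ) (lam : ℝ → Cotangent) : Prop where
  hasDerivAt : ∀ t, HasDerivAt lam (hamiltonianField ε (lam t)) t
  level : ∀ t, hamiltonian ε (lam t) = -1 / 2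

/-- The covector `h₁ = -cosh θ`, `h₂ = sinh θ cos φ`, `ε h₃ = sinh θ sin φ` at the identity
`q₀ = (0, 0, 0)`. -/
def initialCovector (ε θ φ : ℝ) : Cotangent :=
  ((-Real.cosh θ, Real.sinh θ * Real.cos φ, Real.sinh θ * Real.sin φ / ε), (0, 0, 0))

theorem eq_of_hasDerivAt_eq {f g k : ℝ → ℝ} (hf : ∀ t, HasDerivAt f (k t) t)
    (hg : ∀ t, HasDerivAt g (k t) t) (h0 : f 0 = g 0) (t : ℝ) : f t = g t := by
  have h : ∀ s, HasDerivAt (f - g) 0 s := fun s =>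
    ((hf s).sub (hg s)).congr_deriv (sub_self _)
  have := is_const_of_deriv_eq_zero (fun s => (h s).differentiableAt) (fun s => (h s).deriv) t 0
  simp only [Pi.sub_apply] at this
  linarith

theorem eq_exp_of_hasDerivAt {f : ℝ → ℝ} {c : ℝ} (hf : ∀ t, HasDerivAt f (c * f t) t) (t : ℝ) :
    f t = f 0 * Real.exp (c * t) := by
  have h : ∀ s, HasDerivAt (fun u => f u * Real.exp (-c * u)) 0 s := fun s => by
    have e : HasDerivAt (fun u : ℝ => Real.exp (-c * u)) (Real.exp (-c * s) * (-c * 1)) s :=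
      ((hasDerivAt_id s).const_mul (-c)).exp
    exact ((hf s).mul e).congr_deriv (by ring)
  have h2 := is_const_of_deriv_eq_zero (fun s => (h s).differentiableAt)
    (fun s => (h s).deriv) t 0
  simp only [mul_zero, Real.exp_zero, mul_one] at h2
  rw [← h2, mul_assoc, ← Real.exp_add]
  simp

theorem hasDerivAt_fst {E F : Type} [NormedAddCommGroup E] [NormedSpace ℝ E]
    [NormedAddCommGroup F] [NormedSpace ℝ F] {f : ℝ → E × F} {v : E × F} {t : ℝ}
    (hf : HasDerivAt f v t) : HasDerivAt (fun s => (f s).1) v.1 t :=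
  ((ContinuousLinearMap.fst ℝ E F).hasFDerivAt (x := f t)).comp_hasDerivAt t hf

theorem hasDerivAt_snd {E F : Type} [NormedAddCommGroup E] [NormedSpace ℝ E]
    [NormedAddCommGroup F] [NormedSpace ℝ F] {f : ℝ → E × F} {v : E × F} {t : ℝ}
    (hf : HasDerivAt f v t) : HasDerivAt (fun s => (f s).2) v.2 t :=
  ((ContinuousLinearMap.snd ℝ E F).hasFDerivAt (x := f t)).comp_hasDerivAt t hf

/-- The components of a normal extremal satisfy the Hamiltonian system. -/
theorem IsNormalExtremal.components {ε : ℝ} {lam : ℝ → Cotangent} (h : IsNormalExtremal ε lam) :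
    (∀ t, HasDerivAt (fun s => (lam s).1.1) (-((lam t).1.2.1 * (lam t).1.2.2)) t) ∧
    (∀ t, HasDerivAt (fun s => (lam s).1.2.1) (-((lam t).1.1 * (lam t).1.2.2)) t) ∧
    (∀ t, HasDerivAt (fun s => (lam s).1.2.2) 0 t) ∧
    (∀ t, HasDerivAt (fun s => (lam s).2.1) (-(lam t).1.1) t) ∧
    (∀ t, HasDerivAt (fun s => (lam s).2.2.1) ((lam t).1.2.1) t) ∧
    (∀ t, HasDerivAt (fun s => (lam s).2.2.2) ((lam t).1.1 * ((lam t).2.2.1 / 2) +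
      (lam t).1.2.1 * ((lam t).2.1 / 2) + ε ^ 2 * (lam t).1.2.2) t) := by
  have d := h.hasDerivAt
  exact ⟨fun t => (hasDerivAt_fst (hasDerivAt_fst (d t)) :),
    fun t => (hasDerivAt_fst (hasDerivAt_snd (hasDerivAt_fst (d t))) :),
    fun t => (hasDerivAt_snd (hasDerivAt_snd (hasDerivAt_fst (d t))) :),
    fun t => (hasDerivAt_fst (hasDerivAt_snd (d t)) :),
    fun t => (hasDerivAt_fst (hasDerivAt_snd (hasDerivAt_snd (d t))) :),
    fun t => (hasDerivAt_snd (hasDerivAt_snd (hasDerivAt_snd (d t))) :)⟩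

theorem IsNormalExtremal.unique {ε : ℝ} {lam mu : ℝ → Cotangent} (hl : IsNormalExtremal ε lam)
    (hm : IsNormalExtremal ε mu) (h0 : lam 0 = mu 0) : lam = mu := by
  obtain ⟨l1, l2, l3, lx, ly, lz⟩ := hl.components
  obtain ⟨m1, m2, m3, mx, my, mz⟩ := hm.components
  have e3 := eq_of_hasDerivAt_eq l3 m3 (by simp only [h0])
  have c3 := eq_of_hasDerivAt_eq l3 (fun t => hasDerivAt_const t (lam 0).1.2.2) rfl
  have cm3 : ∀ t, (mu t).1.2.2 = (lam 0).1.2.2 := fun t => (e3 t).symm.trans (c3 t)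
  have lp := eq_exp_of_hasDerivAt (f := fun t => (lam t).1.1 + (lam t).1.2.1)
    (c := -(lam 0).1.2.2) (fun t => by
      exact ((l1 t).add (l2 t)).congr_deriv (by rw [c3 t]; ring))
  have ln := eq_exp_of_hasDerivAt (f := fun t => (lam t).1.1 - (lam t).1.2.1)
    (c := (lam 0).1.2.2) (fun t => by
      exact ((l1 t).sub (l2 t)).congr_deriv (by rw [c3 t]; ring))
  have mp := eq_exp_of_hasDerivAt (f := fun t => (mu t).1.1 + (mu t).1.2.1)
    (c := -(lam 0).1.2.2) (fun t => by
      exact ((m1 t).add (m2 t)).congr_deriv (by rw [cm3 t]; ring))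
  have mn := eq_exp_of_hasDerivAt (f := fun t => (mu t).1.1 - (mu t).1.2.1)
    (c := (lam 0).1.2.2) (fun t => by
      exact ((m1 t).sub (m2 t)).congr_deriv (by rw [cm3 t]; ring))
  simp only [← h0] at mp mn
  have e1 : ∀ t, (lam t).1.1 = (mu t).1.1 := fun t => by
    linarith [lp t, ln t, mp t, mn t]
  have e2 : ∀ t, (lam t).1.2.1 = (mu t).1.2.1 := fun t => by
    linarith [lp t, ln t, mp t, mn t]
  have ex := eq_of_hasDerivAt_eq lx (fun t => by rw [e1 t]; exact mx t) (by simp only [h0])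
  have ey := eq_of_hasDerivAt_eq ly (fun t => by rw [e2 t]; exact my t) (by simp only [h0])
  have ez := eq_of_hasDerivAt_eq lz
    (fun t => by rw [e1 t, e2 t, e3 t, ex t, ey t]; exact mz t) (by simp only [h0])
  funext t
  exact Prod.ext (Prod.ext (e1 t) (Prod.ext (e2 t) (e3 t)))
    (Prod.ext (ex t) (Prod.ext (ey t) (ez t)))

theorem exists_isNormalExtremal {ε : ℝ} (a b c : ℝ)
    (hlev : -a ^ 2 + b ^ 2 + ε ^ 2 * c ^ 2 = -1) :
    ∃ lam, IsNormalExtremal ε lam ∧ lam 0 = ((a, b, c), (0, 0, 0)) := by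
  rcases eq_or_ne c 0 with rfl | hc
  · refine ⟨fun t => ((a, b, 0), (-a * t, b * t, 0)), ⟨fun t => ?_, fun t => ?_⟩, by simp⟩
    · have hx : HasDerivAt (fun t => -a * t) (-a) t := by
        simpa using (hasDerivAt_id t).const_mul (-a)
      have hy : HasDerivAt (fun t => b * t) b t := by
        simpa using (hasDerivAt_id t).const_mul b
      refine HasDerivAt.congr_deriv ((hasDerivAt_const t ((a, b, (0 : ℝ)) : ℝ × ℝ × ℝ)).prodMk
        (hx.prodMk (hy.prodMk (hasDerivAt_const t (0 : ℝ))))) ?_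
      simp only [hamiltonianField, Prod.mk.injEq]
      refine ⟨?_, trivial, trivial, by ring⟩
      ext <;> simp
    · simp only [hamiltonian]
      linarith
  · have hτ : ∀ t, HasDerivAt (fun s : ℝ => c * s) c t := fun t => by
      simpa using (hasDerivAt_id t).const_mul c
    have hs := fun t => (hτ t).sinh
    have hch := fun t => (hτ t).cosh
    refine ⟨fun t =>
      ((a * Real.cosh (c * t) - b * Real.sinh (c * t),
        b * Real.cosh (c * t) - a * Real.sinh (c * t), c),
       ((-a * Real.sinh (c * t) + b * (Real.cosh (c * t) - 1)) / c,
        (b * Real.sinh (c * t) - a * (Real.cosh (c * t) - 1)) / c,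
        (Real.sinh (c * t) - c * t) / (2 * c ^ 2) +
          ε ^ 2 / 2 * (Real.sinh (c * t) + c * t))), ⟨fun t => ?_, fun t => ?_⟩, by simp⟩
    · refine HasDerivAt.congr_deriv (((((hch t).const_mul a).sub ((hs t).const_mul b)).prodMk
        ((((hch t).const_mul b).sub ((hs t).const_mul a)).prodMk (hasDerivAt_const t c))).prodMk
        (((((hs t).const_mul (-a)).add (((hch t).sub_const 1).const_mul b)).div_const c).prodMk
        (((((hs t).const_mul b).sub (((hch t).sub_const 1).const_mul a)).div_const c).prodMk
        ((((hs t).sub (hτ t)).div_const (2 * c ^ 2)).add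
          (((hs t).add (hτ t)).const_mul (ε ^ 2 / 2)))))) ?_
      have hcs := Real.cosh_sq (c * t)
      simp only [hamiltonianField, Prod.mk.injEq]
      refine ⟨⟨by ring, by ring, trivial⟩, by field_simp; ring, by field_simp, ?_⟩
      have hab : a ^ 2 - b ^ 2 = 1 + ε ^ 2 * c ^ 2 := by linarith
      field_simp
      generalize Real.cosh (c * t) = C at *
      generalize Real.sinh (c * t) = S at *
      linear_combination (1 - C) * hab + (a ^ 2 - b ^ 2) * hcs
    · have hcs := Real.cosh_sq (c * t)
      simp only [hamiltonian]
      generalize Real.cosh (c * t) = C at *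
      generalize Real.sinh (c * t) = S at *
      linear_combination (1 / 2) * hlev + (b ^ 2 - a ^ 2) / 2 * hcs

/-- Through every covector of the level surface over the identity passes exactly one normal
extremal, defined for all times. -/
theorem existsUnique_isNormalExtremal {ε : ℝ} (hε : 0 < ε) (θ φ : ℝ) :
    ∃! lam, IsNormalExtremal ε lam ∧ lam 0 = initialCovector ε θ φ := by
  obtain ⟨lam, h1, h2⟩ := exists_isNormalExtremal (ε := ε) (-Real.cosh θ) (Real.sinh θ * Real.cos φ)
    (Real.sinh θ * Real.sin φ / ε) (by
      field_simp
      linear_combination (-1 : ℝ) * Real.cosh_sq θ + Real.sinh θ ^ 2 * Real.sin_sq_add_cos_sq φ)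
  exact ⟨lam, ⟨h1, h2⟩, fun mu hmu => hmu.1.unique h1 (hmu.2.trans h2.symm)⟩

/-- The normal extremal that starts from the covector with the parameters `(θ, φ)`. -/
def extremal {ε : ℝ} (hε : 0 < ε) (θ φ : ℝ) : ℝ → Cotangent :=
  (existsUnique_isNormalExtremal hε θ φ).choose

theorem extremal_spec {ε : ℝ} (hε : 0 < ε) (θ φ : ℝ) :
    IsNormalExtremal ε (extremal hε θ φ) ∧ extremal hε θ φ 0 = initialCovector ε θ φ :=
  (existsUnique_isNormalExtremal hε θ φ).choose_spec.1

/-- The exponential mapping `(θ, φ, t) ↦ q(t)`: the projection to `M` of the normal extremal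
that starts from the covector with the parameters `(θ, φ)`. -/
def Exp {ε : ℝ} (hε : 0 < ε) (θ φ t : ℝ) : M := (extremal hε θ φ t).2

/-- The exponential mapping in the coordinates `(θ, φ, τ)`, where `τ = h₃ t` and
`h₃ = sinh θ sin φ / ε`. -/
def ExpTau {ε : ℝ} (hε : 0 < ε) : ℝ × ℝ × ℝ → M :=
  fun ⟨θ, φ, τ⟩ => Exp hε θ φ (τ / (Real.sinh θ * Real.sin φ / ε))

/-- The domain `N` in the preimage of the exponential mapping. -/
def N : Set (ℝ × ℝ × ℝ) :=
  {ν | 0 < ν.1 ∧ ν.2.1 ∈ Ioo 0 Real.pi ∧ 0 < ν.2.2}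

/-- The set `D₊`. For `x > y` the argument of `arcosh` is at least `1` only if `x ≥ |y|`, and
`x = -y` would give `τ = 0`, hence no admissible `z`: so `x > |y|` is what `x > y` means here
(see `mem_Dplus_iff`). -/
def Dplus (ε : ℝ) : Set M :=
  {q | |q.2.1| < q.1 ∧ ∃ τ, τ = Real.arcosh ((q.1 ^ 2 - q.2.1 ^ 2) / (2 * ε ^ 2) + 1) ∧
    0 < q.2.2 ∧ q.2.2 < ε ^ 2 / 2 * (Real.sinh τ + τ)}

theorem mem_Dplus_iff {ε : ℝ} (hε : 0 < ε) (q : M) :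
    q ∈ Dplus ε ↔ q.2.1 < q.1 ∧ 1 ≤ (q.1 ^ 2 - q.2.1 ^ 2) / (2 * ε ^ 2) + 1 ∧
      ∃ τ, τ = Real.arcosh ((q.1 ^ 2 - q.2.1 ^ 2) / (2 * ε ^ 2) + 1) ∧
        0 < q.2.2 ∧ q.2.2 < ε ^ 2 / 2 * (Real.sinh τ + τ) := by
  obtain ⟨x, y, z⟩ := q
  simp only [Dplus, mem_ofPred_eq]
  constructor
  · rintro ⟨h, h2⟩
    have h3 : y ^ 2 ≤ x ^ 2 := by
      rw [sq_le_sq]; exact h.le.trans (le_abs_self x)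
    have h4 : 0 ≤ (x ^ 2 - y ^ 2) / (2 * ε ^ 2) :=
      div_nonneg (by linarith) (by positivity)
    exact ⟨(le_abs_self y).trans_lt h, by linarith, h2⟩
  · rintro ⟨h, h1, τ, hτ, h2, h3⟩
    refine ⟨?_, τ, hτ, h2, h3⟩
    have h4 : 0 ≤ x ^ 2 - y ^ 2 := by
      by_contra hn
      have := div_neg_of_neg_of_pos (not_le.mp hn) (show 0 < 2 * ε ^ 2 by positivity)
      linarith
    have h5 : 0 ≤ x + y := by
      by_contra hn
      nlinarith
    have h6 : x + y ≠ 0 := by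
      intro h6
      have : x ^ 2 - y ^ 2 = 0 := by linear_combination (x - y) * h6
      rw [this] at hτ
      simp [Real.arcosh] at hτ
      subst hτ
      simp at h3
      linarith
    exact abs_lt.mpr ⟨by linarith [lt_of_le_of_ne h5 h6.symm], h⟩

end HeisenbergLorentz

end

namespace HeisenbergLorentz

open Filter Topology

/-! The inverse of `ExpTau` is written down, up to one scalar equation. Put h = cosh θ, w = sinh θ
cos φ, s = sinh θ sin φ, so h² = 1 + w² + s². Integrating the Hamiltonian system gives `endpoint`,
where c = (x² - y²)/(2ε²) equals (1 + 1/s²)(cosh τ - 1). Eliminating 1/s² from z leaves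
`scaledHeight c τ` = 2z/ε², an equation for τ in terms of q alone. For c > 0 its left side increases
strictly in τ > 0 and takes every positive value, because 2(cosh τ - 1) < τ sinh τ. So z > 0
determines τ (`scaledTime`), smoothly by the implicit function theorem. Then s is recovered from
1/s² = c/(cosh τ - 1) - 1, which needs cosh τ - 1 < c, that is τ < T; by monotonicity this is
exactly the upper bound on z in `Dplus`. Finally (h, w) solves a linear system, and (θ, φ) are polar
coordinates of (w, s). -/

/-- A solution of an implicit scalar equation with non-vanishing derivative in the unknown is
smooth, provided that it is locally the only one. -/
theorem contDiffAt_of_locally_unique_solution {E : Type*} [NormedAddCommGroup E] [NormedSpace ℝ E]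
    [CompleteSpace E] {G : E × ℝ → ℝ} {g : E → ℝ} {e : E} {d : ℝ}
    (hG : ContDiffAt ℝ ∞ G (e, g e)) (hd : HasDerivAt (fun t => G (e, t)) d (g e)) (hd0 : d ≠ 0)
    (huniq : ∀ᶠ v in 𝓝 (e, g e), G v = G (e, g e) → v.2 = g v.1) : ContDiffAt ℝ ∞ g e := by
  have hn : (∞ : WithTop ℕ∞) ≠ 0 := by simp
  have hfd : HasFDerivAt G (fderiv ℝ G (e, g e)) (e, g e) :=
    (hG.differentiableAt hn).hasFDerivAt
  have hcomp : HasDerivAt (fun t => G (e, t)) (fderiv ℝ G (e, g e) (0, 1)) (g e) :=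
    HasFDerivAt.comp_hasDerivAt (g e) (f := fun t => (e, t)) hfd
      ((hasDerivAt_const (g e) e).prodMk (hasDerivAt_id (g e)))
  have hval : fderiv ℝ G (e, g e) (0, 1) = d := hcomp.unique hd
  have hinv : (fderiv ℝ G (e, g e) ∘L .inr ℝ E ℝ).IsInvertible := by
    refine ⟨ContinuousLinearEquiv.unitsEquivAut ℝ (Units.mk0 d hd0), ?_⟩
    ext
    simp [hval]
  have hψ := hG.contDiffAt_implicitFunction hn hinv
  have hψ0 : hG.implicitFunction hn hinv e = g e := hG.implicitFunction_apply_self hn hinv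
  -- Continuity of `g` is not assumed: local uniqueness is applied along the graph of the implicit
  -- function, which does tend to `(e, g e)`.
  have htend : Tendsto (fun x => (x, hG.implicitFunction hn hinv x)) (𝓝 e) (𝓝 (e, g e)) := by
    have h := (continuousAt_id (x := e)).prodMk hψ.continuousAt
    simpa only [ContinuousAt, hψ0, id] using h
  refine hψ.congr_of_eventuallyEq ?_
  filter_upwards [htend.eventually huniq, hG.eventually_apply_implicitFunction hn hinv] with x h1 h2
  exact (h1 h2).symm

/-! ### Hyperbolic inequalities -/

theorem pos_of_hasDerivAt_pos {f f' : ℝ → ℝ} (hf : ∀ t, HasDerivAt f (f' t) t)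
    (hpos : ∀ t, 0 < t → 0 < f' t) (h0 : f 0 = 0) {t : ℝ} (ht : 0 < t) : 0 < f t := by
  have hmono : StrictMonoOn f (Ici 0) := by
    refine strictMonoOn_of_deriv_pos (convex_Ici 0)
      (fun x _ => (hf x).continuousAt.continuousWithinAt) fun x hx => ?_
    rw [interior_Ici] at hx
    rw [(hf x).deriv]
    exact hpos x hx
  simpa only [h0] using hmono (mem_Ici.2 le_rfl) (mem_Ici.2 ht.le) ht

theorem sinh_lt_mul_cosh {t : ℝ} (ht : 0 < t) : Real.sinh t < t * Real.cosh t := by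
  have h := pos_of_hasDerivAt_pos (f := fun t => t * Real.cosh t - Real.sinh t)
    (f' := fun t => t * Real.sinh t)
    (fun t => (((hasDerivAt_id t).mul (Real.hasDerivAt_cosh t)).sub
      (Real.hasDerivAt_sinh t)).congr_deriv (by simp))
    (fun t ht => mul_pos ht (Real.sinh_pos_iff.2 ht)) (by simp) ht
  linarith

/-- The difference has derivative t cosh t - sinh t > 0. It is the numerator of the derivative of
(sinh t - t)/(cosh t - 1), so that quotient increases. -/
theorem two_mul_cosh_sub_one_lt {t : ℝ} (ht : 0 < t) :
    2 * (Real.cosh t - 1) < t * Real.sinh t := by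
  have h := pos_of_hasDerivAt_pos (f := fun t => t * Real.sinh t - 2 * (Real.cosh t - 1))
    (f' := fun t => t * Real.cosh t - Real.sinh t)
    (fun t => (((hasDerivAt_id t).mul (Real.hasDerivAt_sinh t)).sub
      (((Real.hasDerivAt_cosh t).sub_const 1).const_mul 2)).congr_deriv (by simp; ring))
    (fun t ht => sub_pos.2 (sinh_lt_mul_cosh ht)) (by simp) ht
  linarith

theorem cosh_sub_one_pos {t : ℝ} (ht : 0 < t) : 0 < Real.cosh t - 1 :=
  sub_pos.2 (Real.one_lt_cosh.2 ht.ne')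

/-! ### The height equation and its solution -/

/-- The rescaled height `2 z / ε²` of the end point of an extremal, as a function of
`c = (x² - y²) / (2 ε²)` and `τ`. -/
noncomputable def scaledHeight (c τ : ℝ) : ℝ :=
  c * ((Real.sinh τ - τ) / (Real.cosh τ - 1)) + 2 * τ

theorem hasDerivAt_scaledHeight (c : ℝ) {τ : ℝ} (hτ : 0 < τ) :
    HasDerivAt (scaledHeight c)
      (c * ((τ * Real.sinh τ - 2 * (Real.cosh τ - 1)) / (Real.cosh τ - 1) ^ 2) + 2) τ := by
  have hp := (cosh_sub_one_pos hτ).ne'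
  refine HasDerivAt.congr_deriv (((((Real.hasDerivAt_sinh τ).sub (hasDerivAt_id τ)).div
    ((Real.hasDerivAt_cosh τ).sub_const 1) hp).const_mul c).add
    ((hasDerivAt_id τ).const_mul 2)) ?_
  simp only [Pi.sub_apply, id, mul_one]
  congr 3
  linear_combination Real.cosh_sq τ

theorem scaledHeight_deriv_pos {c τ : ℝ} (hc : 0 ≤ c) (hτ : 0 < τ) :
    0 < c * ((τ * Real.sinh τ - 2 * (Real.cosh τ - 1)) / (Real.cosh τ - 1) ^ 2) + 2 := by
  have := sub_pos.2 (two_mul_cosh_sub_one_lt hτ)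
  positivity

theorem strictMonoOn_scaledHeight {c : ℝ} (hc : 0 ≤ c) :
    StrictMonoOn (scaledHeight c) (Ioi 0) := by
  refine strictMonoOn_of_deriv_pos (convex_Ioi 0)
    (fun x hx => (hasDerivAt_scaledHeight c hx).continuousAt.continuousWithinAt) fun x hx => ?_
  rw [interior_Ioi] at hx
  rw [(hasDerivAt_scaledHeight c hx).deriv]
  exact scaledHeight_deriv_pos hc hx

theorem scaledHeight_le {c τ : ℝ} (hc : 0 ≤ c) (hτ : 0 < τ) :
    scaledHeight c τ ≤ (c + 2) * τ := by
  have h1 : (Real.sinh τ - τ) / (Real.cosh τ - 1) ≤ τ := by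
    rw [div_le_iff₀ (cosh_sub_one_pos hτ)]
    linarith [sinh_lt_mul_cosh hτ]
  have := mul_le_mul_of_nonneg_left h1 hc
  unfold scaledHeight
  linarith

theorem two_mul_le_scaledHeight {c τ : ℝ} (hc : 0 ≤ c) (hτ : 0 < τ) :
    2 * τ ≤ scaledHeight c τ := by
  have h1 : 0 ≤ (Real.sinh τ - τ) / (Real.cosh τ - 1) :=
    div_nonneg (sub_nonneg.2 (Real.self_le_sinh_iff.2 hτ.le)) (cosh_sub_one_pos hτ).le
  have := mul_nonneg hc h1
  unfold scaledHeight
  linarith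

/-- At cosh T = c + 1 the height equation gives the upper boundary of `Dplus`. -/
theorem scaledHeight_cosh_sub_one {T : ℝ} (hT : 0 < T) :
    scaledHeight (Real.cosh T - 1) T = Real.sinh T + T := by
  unfold scaledHeight
  rw [mul_div_cancel₀ _ (cosh_sub_one_pos hT).ne']
  ring

theorem exists_scaledHeight_eq {c h : ℝ} (hc : 0 < c) (hh : 0 < h) :
    ∃ τ, 0 < τ ∧ scaledHeight c τ = h := by
  -- The bracket [h/(c + 2), h] comes from 2τ ≤ `scaledHeight c τ` ≤ (c + 2)τ; it avoids τ = 0,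
  -- where the quotient is 0/0.
  have ha : 0 < h / (c + 2) := by positivity
  have hab : h / (c + 2) ≤ h := div_le_self hh.le (by linarith)
  have hcont : ContinuousOn (scaledHeight c) (Icc (h / (c + 2)) h) := fun x hx =>
    (hasDerivAt_scaledHeight c (ha.trans_le hx.1)).continuousAt.continuousWithinAt
  have hmem : h ∈ Icc (scaledHeight c (h / (c + 2))) (scaledHeight c h) :=
    ⟨(scaledHeight_le hc.le ha).trans_eq (by field_simp),
      by linarith [two_mul_le_scaledHeight hc.le hh]⟩
  obtain ⟨τ, hτ, e⟩ := intermediate_value_Icc hab hcont hmem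
  exact ⟨τ, ha.trans_le hτ.1, e⟩

open Classical in
/-- The positive solution `τ` of `scaledHeight c τ = h`. -/
noncomputable def scaledTime (p : ℝ × ℝ) : ℝ :=
  if h : 0 < p.1 ∧ 0 < p.2 then (exists_scaledHeight_eq h.1 h.2).choose else 0

theorem scaledTime_pos {c h : ℝ} (hc : 0 < c) (hh : 0 < h) : 0 < scaledTime (c, h) := by
  rw [scaledTime, dif_pos ⟨hc, hh⟩]
  exact (exists_scaledHeight_eq hc hh).choose_spec.1

theorem scaledHeight_scaledTime {c h : ℝ} (hc : 0 < c) (hh : 0 < h) :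
    scaledHeight c (scaledTime (c, h)) = h := by
  rw [scaledTime, dif_pos ⟨hc, hh⟩]
  exact (exists_scaledHeight_eq hc hh).choose_spec.2

theorem scaledTime_scaledHeight {c τ : ℝ} (hc : 0 < c) (hτ : 0 < τ) :
    scaledTime (c, scaledHeight c τ) = τ := by
  have hh : 0 < scaledHeight c τ := by linarith [two_mul_le_scaledHeight hc.le hτ]
  exact (strictMonoOn_scaledHeight hc.le).injOn (scaledTime_pos hc hh) hτ
    (scaledHeight_scaledTime hc hh)

theorem contDiffAt_scaledTime {c h : ℝ} (hc : 0 < c) (hh : 0 < h) :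
    ContDiffAt ℝ ∞ scaledTime (c, h) := by
  have hτ := scaledTime_pos hc hh
  have hp := (cosh_sub_one_pos hτ).ne'
  refine contDiffAt_of_locally_unique_solution
    (G := fun v : (ℝ × ℝ) × ℝ => scaledHeight v.1.1 v.2 - v.1.2) ?_
    ((hasDerivAt_scaledHeight c hτ).sub_const h) (scaledHeight_deriv_pos hc.le hτ).ne' ?_
  · unfold scaledHeight
    refine ContDiffAt.sub (ContDiffAt.add (ContDiffAt.mul (by fun_prop) (ContDiffAt.div ?_ ?_ hp))
      (by fun_prop)) (by fun_prop)
    · exact (Real.contDiff_sinh.contDiffAt.comp _ contDiffAt_snd).sub contDiffAt_snd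
    · exact (Real.contDiff_cosh.contDiffAt.comp _ contDiffAt_snd).sub contDiffAt_const
  · have h1 : ∀ᶠ v : (ℝ × ℝ) × ℝ in 𝓝 ((c, h), scaledTime (c, h)), 0 < v.1.1 :=
      (by fun_prop : Continuous fun v : (ℝ × ℝ) × ℝ => v.1.1).continuousAt.eventually
        (lt_mem_nhds hc)
    have h2 : ∀ᶠ v : (ℝ × ℝ) × ℝ in 𝓝 ((c, h), scaledTime (c, h)), 0 < v.2 :=
      continuous_snd.continuousAt.eventually (lt_mem_nhds hτ)
    filter_upwards [h1, h2] with v hv1 hv2 hv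
    -- Near the base point both c and τ stay positive, so injectivity in τ gives local uniqueness.
    simp only [scaledHeight_scaledTime hc hh, sub_self] at hv
    have := scaledTime_scaledHeight hv1 hv2
    rw [sub_eq_zero.1 hv] at this
    exact this.symm

/-! ### Explicit extremals and their end points -/

/-- The normal extremal through `((a, b, c), (0, 0, 0))` for `c ≠ 0`. -/
noncomputable def explicitExtremal (ε a b c : ℝ) (t : ℝ) : Cotangent :=
  ((a * Real.cosh (c * t) - b * Real.sinh (c * t),
    b * Real.cosh (c * t) - a * Real.sinh (c * t), c),
   ((-a * Real.sinh (c * t) + b * (Real.cosh (c * t) - 1)) / c,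
    (b * Real.sinh (c * t) - a * (Real.cosh (c * t) - 1)) / c,
    (Real.sinh (c * t) - c * t) / (2 * c ^ 2) +
      ε ^ 2 / 2 * (Real.sinh (c * t) + c * t)))

theorem isNormalExtremal_explicitExtremal {ε a b c : ℝ}
    (hlev : -a ^ 2 + b ^ 2 + ε ^ 2 * c ^ 2 = -1) (hc : c ≠ 0) :
    IsNormalExtremal ε (explicitExtremal ε a b c) := by
  have hτ : ∀ t, HasDerivAt (fun s : ℝ => c * s) c t := fun t => by
    simpa using (hasDerivAt_id t).const_mul c
  have hs := fun t => (hτ t).sinh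
  have hch := fun t => (hτ t).cosh
  refine ⟨fun t => ?_, fun t => ?_⟩
  · refine HasDerivAt.congr_deriv (((((hch t).const_mul a).sub ((hs t).const_mul b)).prodMk
      ((((hch t).const_mul b).sub ((hs t).const_mul a)).prodMk (hasDerivAt_const t c))).prodMk
      (((((hs t).const_mul (-a)).add (((hch t).sub_const 1).const_mul b)).div_const c).prodMk
      (((((hs t).const_mul b).sub (((hch t).sub_const 1).const_mul a)).div_const c).prodMk
      ((((hs t).sub (hτ t)).div_const (2 * c ^ 2)).add
        (((hs t).add (hτ t)).const_mul (ε ^ 2 / 2)))))) ?_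
    have hcs := Real.cosh_sq (c * t)
    simp only [hamiltonianField, explicitExtremal, Prod.mk.injEq]
    refine ⟨⟨by ring, by ring, trivial⟩, by field_simp; ring, by field_simp, ?_⟩
    -- The equation for z is the only one that needs the level surface.
    have hab : a ^ 2 - b ^ 2 = 1 + ε ^ 2 * c ^ 2 := by linarith
    field_simp
    generalize Real.cosh (c * t) = C at *
    generalize Real.sinh (c * t) = S at *
    linear_combination (1 - C) * hab + (a ^ 2 - b ^ 2) * hcs
  · have hcs := Real.cosh_sq (c * t)
    simp only [hamiltonian, explicitExtremal]
    generalize Real.cosh (c * t) = C at *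
    generalize Real.sinh (c * t) = S at *
    linear_combination (1 / 2) * hlev + (b ^ 2 - a ^ 2) / 2 * hcs

/-- The end point at the time `τ` of the extremal with `h₁(0) = -h`, `h₂(0) = w`,
`ε h₃(0) = s`. -/
noncomputable def endpoint (ε h w s τ : ℝ) : M :=
  ((h * Real.sinh τ + w * (Real.cosh τ - 1)) * (ε / s),
   (w * Real.sinh τ + h * (Real.cosh τ - 1)) * (ε / s),
   ε ^ 2 / 2 * ((Real.sinh τ - τ) / s ^ 2 + (Real.sinh τ + τ)))

/-- Uniqueness replaces the chosen extremal by the explicit one, and at time τ/h₃ the hyperbolic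
argument h₃t becomes τ. -/
theorem ExpTau_eq_endpoint {ε : ℝ} (hε : 0 < ε) {θ φ : ℝ} (τ : ℝ)
    (hs : Real.sinh θ * Real.sin φ ≠ 0) :
    ExpTau hε (θ, φ, τ) =
      endpoint ε (Real.cosh θ) (Real.sinh θ * Real.cos φ) (Real.sinh θ * Real.sin φ) τ := by
  obtain ⟨h1, h2⟩ := extremal_spec hε θ φ
  have hc : Real.sinh θ * Real.sin φ / ε ≠ 0 := div_ne_zero hs hε.ne'
  have h3 := isNormalExtremal_explicitExtremal (ε := ε) (a := -Real.cosh θ)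
    (b := Real.sinh θ * Real.cos φ) (c := Real.sinh θ * Real.sin φ / ε) (by
      field_simp
      linear_combination (-1 : ℝ) * Real.cosh_sq θ +
        Real.sinh θ ^ 2 * Real.sin_sq_add_cos_sq φ) hc
  have h4 := h1.unique h3 (by rw [h2]; simp [initialCovector, explicitExtremal])
  simp only [ExpTau, Exp, h4, explicitExtremal, mul_div_cancel₀ _ hc, endpoint, Prod.mk.injEq]
  generalize Real.sinh θ * Real.sin φ = s at *
  refine ⟨?_, ?_, ?_⟩ <;> field_simp
  ring

/-! ### The Lorentz invariant and the image -/

variable {ε : ℝ}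

/-- Up to the factor (ε/s)², this is the determinant of the linear map (h, w) ↦ (x, y). -/
theorem sinh_sq_sub_cosh_sub_one_sq (τ : ℝ) :
    Real.sinh τ ^ 2 - (Real.cosh τ - 1) ^ 2 = 2 * (Real.cosh τ - 1) := by
  linear_combination -Real.cosh_sq τ

theorem cosh_sub_one_lt_sinh {τ : ℝ} (hτ : 0 < τ) : Real.cosh τ - 1 < Real.sinh τ := by
  have h1 := Real.cosh_sub_sinh τ
  have h2 : Real.exp (-τ) < 1 := by simpa using hτ
  linarith

/-- The quotient `(x² - y²) / (2 ε²)`. -/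
noncomputable def lorentzSq (ε : ℝ) (q : M) : ℝ := (q.1 ^ 2 - q.2.1 ^ 2) / (2 * ε ^ 2)

/-- The map (h, w) ↦ (x, y) multiplies h² - w² = 1 + s² by a factor depending only on ε, s and τ, so
w drops out. -/
theorem lorentzSq_endpoint (hε : 0 < ε) {h w s : ℝ} (hs : 0 < s) (hh : h ^ 2 = 1 + w ^ 2 + s ^ 2)
    (τ : ℝ) : lorentzSq ε (endpoint ε h w s τ) = (1 + 1 / s ^ 2) * (Real.cosh τ - 1) := by
  have hS := sinh_sq_sub_cosh_sub_one_sq τ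
  simp only [lorentzSq, endpoint]
  field_simp
  linear_combination (h ^ 2 - w ^ 2) * hS + 2 * (Real.cosh τ - 1) * hh

/-- In null coordinates x ± y = (h ± w)(sinh τ ± (cosh τ - 1)) ε/s, a product of positive factors.
-/
theorem abs_snd_endpoint_lt (hε : 0 < ε) {h w s τ : ℝ} (hs : 0 < s) (hh0 : 0 < h)
    (hh : h ^ 2 = 1 + w ^ 2 + s ^ 2) (hτ : 0 < τ) :
    |(endpoint ε h w s τ).2.1| < (endpoint ε h w s τ).1 := by
  obtain ⟨hw1, hw2⟩ := abs_lt.1 (abs_lt_of_sq_lt_sq (by nlinarith : w ^ 2 < h ^ 2) hh0.le)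
  have hS := cosh_sub_one_lt_sinh hτ
  have hC := cosh_sub_one_pos hτ
  have hk : 0 < ε / s := div_pos hε hs
  simp only [endpoint]
  rw [abs_lt, ← neg_mul]
  constructor <;> refine mul_lt_mul_of_pos_right ?_ hk
  · nlinarith [mul_pos (by linarith : 0 < h + w) (by linarith : 0 < Real.sinh τ + (Real.cosh τ - 1))]
  · nlinarith [mul_pos (by linarith : 0 < h - w) (by linarith : 0 < Real.sinh τ - (Real.cosh τ - 1))]

theorem scaledHeight_endpoint (hε : 0 < ε) {h w s τ : ℝ} (hs : 0 < s)
    (hh : h ^ 2 = 1 + w ^ 2 + s ^ 2) (hτ : 0 < τ) :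
    scaledHeight (lorentzSq ε (endpoint ε h w s τ)) τ =
      2 * (endpoint ε h w s τ).2.2 / ε ^ 2 := by
  have hC := (cosh_sub_one_pos hτ).ne'
  rw [lorentzSq_endpoint hε hs hh]
  simp only [scaledHeight, endpoint]
  field_simp
  ring

theorem lorentzSq_pos (hε : 0 < ε) {q : M} (hq : |q.2.1| < q.1) : 0 < lorentzSq ε q := by
  have : q.2.1 ^ 2 < q.1 ^ 2 := sq_lt_sq.2 (hq.trans_le (le_abs_self _))
  unfold lorentzSq
  exact div_pos (by linarith) (by positivity)

/-- `D₊` in terms of the scaled height: the time of arrival is shorter than `T`. -/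
theorem mem_Dplus_iff_exists_scaledHeight (hε : 0 < ε) {q : M} :
    q ∈ Dplus ε ↔ |q.2.1| < q.1 ∧ ∃ τ, 0 < τ ∧ Real.cosh τ - 1 < lorentzSq ε q ∧
      scaledHeight (lorentzSq ε q) τ = 2 * q.2.2 / ε ^ 2 := by
  simp only [Dplus, mem_ofPred_eq, exists_eq_left]
  refine and_congr_right fun hq => ?_
  have hc := lorentzSq_pos hε hq
  change (0 < q.2.2 ∧ q.2.2 < ε ^ 2 / 2 * (Real.sinh (Real.arcosh (lorentzSq ε q + 1)) +
    Real.arcosh (lorentzSq ε q + 1))) ↔ _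
  generalize lorentzSq ε q = c at *
  have hcT : Real.cosh (Real.arcosh (c + 1)) = c + 1 := Real.cosh_arcosh (by linarith)
  have hT : 0 < Real.arcosh (c + 1) := Real.arcosh_pos (by linarith)
  generalize Real.arcosh (c + 1) = T at *
  have hTc : scaledHeight c T = Real.sinh T + T := by
    rw [← scaledHeight_cosh_sub_one hT, hcT, add_sub_cancel_right]
  -- Monotonicity turns τ < T into the upper bound on the height.
  have hlt : ∀ τ, 0 < τ → (Real.cosh τ - 1 < c ↔ scaledHeight c τ < Real.sinh T + T) := by
    intro τ hτ
    rw [← hTc, (strictMonoOn_scaledHeight hc.le).lt_iff_lt hτ hT, sub_lt_iff_lt_add, ← hcT,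
      Real.cosh_lt_cosh, abs_of_pos hτ, abs_of_pos hT]
  have hz : q.2.2 < ε ^ 2 / 2 * (Real.sinh T + T) ↔ 2 * q.2.2 / ε ^ 2 < Real.sinh T + T := by
    rw [div_lt_iff₀ (by positivity)]
    constructor <;> intro h <;> linarith
  rw [hz]
  constructor
  · rintro ⟨h0, h1⟩
    have hh : 0 < 2 * q.2.2 / ε ^ 2 := by positivity
    have e := scaledHeight_scaledTime hc hh
    exact ⟨_, scaledTime_pos hc hh, (hlt _ (scaledTime_pos hc hh)).2 (e.trans_lt h1), e⟩
  · rintro ⟨τ, hτ, h1, h2⟩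
    rw [hlt τ hτ, h2] at h1
    refine ⟨?_, h1⟩
    have h3 : 0 < 2 * q.2.2 / ε ^ 2 := by
      rw [← h2]
      linarith [two_mul_le_scaledHeight hc.le hτ]
    have h4 := (div_pos_iff_of_pos_right (by positivity : 0 < ε ^ 2)).1 h3
    linarith

theorem endpoint_mem_Dplus (hε : 0 < ε) {h w s τ : ℝ} (hs : 0 < s) (hh0 : 0 < h)
    (hh : h ^ 2 = 1 + w ^ 2 + s ^ 2) (hτ : 0 < τ) : endpoint ε h w s τ ∈ Dplus ε := by
  refine (mem_Dplus_iff_exists_scaledHeight hε).2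
    ⟨abs_snd_endpoint_lt hε hs hh0 hh hτ, τ, hτ, ?_, scaledHeight_endpoint hε hs hh hτ⟩
  rw [lorentzSq_endpoint hε hs hh]
  have := mul_pos (by positivity : 0 < 1 / s ^ 2) (cosh_sub_one_pos hτ)
  linarith

/-! ### Recovering the initial covector -/

/-- The time `τ` at which an extremal arrives at the point `q`. -/
noncomputable def arrivalTime (ε : ℝ) (q : M) : ℝ := scaledTime (lorentzSq ε q, 2 * q.2.2 / ε ^ 2)

/-- The value of `ε h₃(0)` for the extremal that arrives at `q`. -/
noncomputable def initialVertical (ε : ℝ) (q : M) : ℝ :=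
  1 / √(lorentzSq ε q / (Real.cosh (arrivalTime ε q) - 1) - 1)

/-- The value of `h₂(0)` for the extremal that arrives at `q`. -/
noncomputable def initialHorizontal (ε : ℝ) (q : M) : ℝ :=
  initialVertical ε q * (q.2.1 * Real.sinh (arrivalTime ε q) -
    q.1 * (Real.cosh (arrivalTime ε q) - 1)) / (2 * ε * (Real.cosh (arrivalTime ε q) - 1))

theorem arrivalTime_endpoint (hε : 0 < ε) {h w s τ : ℝ} (hs : 0 < s) (hh0 : 0 < h)
    (hh : h ^ 2 = 1 + w ^ 2 + s ^ 2) (hτ : 0 < τ) :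
    arrivalTime ε (endpoint ε h w s τ) = τ := by
  rw [arrivalTime, ← scaledHeight_endpoint hε hs hh hτ]
  exact scaledTime_scaledHeight (lorentzSq_pos hε (abs_snd_endpoint_lt hε hs hh0 hh hτ)) hτ

theorem initialVertical_endpoint (hε : 0 < ε) {h w s τ : ℝ} (hs : 0 < s) (hh0 : 0 < h)
    (hh : h ^ 2 = 1 + w ^ 2 + s ^ 2) (hτ : 0 < τ) :
    initialVertical ε (endpoint ε h w s τ) = s := by
  rw [initialVertical, arrivalTime_endpoint hε hs hh0 hh hτ, lorentzSq_endpoint hε hs hh,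
    mul_div_cancel_right₀ _ (cosh_sub_one_pos hτ).ne', add_sub_cancel_left, Real.sqrt_div' _
    (sq_nonneg s), Real.sqrt_one, Real.sqrt_sq hs.le, one_div_one_div]

theorem initialHorizontal_endpoint (hε : 0 < ε) {h w s τ : ℝ} (hs : 0 < s) (hh0 : 0 < h)
    (hh : h ^ 2 = 1 + w ^ 2 + s ^ 2) (hτ : 0 < τ) :
    initialHorizontal ε (endpoint ε h w s τ) = w := by
  rw [initialHorizontal, arrivalTime_endpoint hε hs hh0 hh hτ,
    initialVertical_endpoint hε hs hh0 hh hτ]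
  have hC := (cosh_sub_one_pos hτ).ne'
  simp only [endpoint]
  field_simp
  linear_combination w * sinh_sq_sub_cosh_sub_one_sq τ

theorem arrivalTime_spec (hε : 0 < ε) {q : M} (hq : q ∈ Dplus ε) :
    0 < arrivalTime ε q ∧ Real.cosh (arrivalTime ε q) - 1 < lorentzSq ε q ∧
      scaledHeight (lorentzSq ε q) (arrivalTime ε q) = 2 * q.2.2 / ε ^ 2 := by
  obtain ⟨h1, τ, h2, h3, h4⟩ := (mem_Dplus_iff_exists_scaledHeight hε).1 hq
  have e : arrivalTime ε q = τ := by
    rw [arrivalTime, ← h4, scaledTime_scaledHeight (lorentzSq_pos hε h1) h2]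
  rw [e]
  exact ⟨h2, h3, h4⟩

theorem lorentzSq_div_sub_one_pos (hε : 0 < ε) {q : M} (hq : q ∈ Dplus ε) :
    0 < lorentzSq ε q / (Real.cosh (arrivalTime ε q) - 1) - 1 := by
  obtain ⟨h1, h2, -⟩ := arrivalTime_spec hε hq
  rwa [sub_pos, one_lt_div (cosh_sub_one_pos h1)]

theorem initialVertical_pos (hε : 0 < ε) {q : M} (hq : q ∈ Dplus ε) :
    0 < initialVertical ε q :=
  one_div_pos.2 (Real.sqrt_pos.2 (lorentzSq_div_sub_one_pos hε hq))

/-- Only w, s and τ are read off from q, while h is fixed by the level surface. The point is that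
this h agrees with the value that Cramer's rule gives for the linear system in (h, w). -/
theorem endpoint_initial (hε : 0 < ε) {q : M} (hq : q ∈ Dplus ε) :
    endpoint ε √(1 + initialHorizontal ε q ^ 2 + initialVertical ε q ^ 2)
      (initialHorizontal ε q) (initialVertical ε q) (arrivalTime ε q) = q := by
  obtain ⟨h1, h2, h3⟩ := arrivalTime_spec hε hq
  have hlt := hq.1
  have hs := initialVertical_pos hε hq
  have hsq : 1 + 1 / initialVertical ε q ^ 2 =
      lorentzSq ε q / (Real.cosh (arrivalTime ε q) - 1) := by
    rw [initialVertical, div_pow, one_pow, one_div_one_div,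
      Real.sq_sqrt (lorentzSq_div_sub_one_pos hε hq).le]
    ring
  have hw : initialHorizontal ε q = initialVertical ε q * (q.2.1 * Real.sinh (arrivalTime ε q) -
    q.1 * (Real.cosh (arrivalTime ε q) - 1)) / (2 * ε * (Real.cosh (arrivalTime ε q) - 1)) := rfl
  have hc : lorentzSq ε q = (q.1 ^ 2 - q.2.1 ^ 2) / (2 * ε ^ 2) := rfl
  generalize initialVertical ε q = s at *
  generalize initialHorizontal ε q = w at *
  generalize arrivalTime ε q = τ at *
  generalize lorentzSq ε q = c at *
  obtain ⟨x, y, z⟩ := q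
  dsimp only [endpoint] at *
  have hC := cosh_sub_one_pos h1
  have hS := cosh_sub_one_lt_sinh h1
  have hCS := sinh_sq_sub_cosh_sub_one_sq τ
  unfold scaledHeight at h3
  generalize Real.sinh τ = S at *
  generalize Real.cosh τ - 1 = D at *
  have hD := hC.ne'
  obtain ⟨hy1, hy2⟩ := abs_lt.1 hlt
  -- The Cramer numerator for h is x(S - D) + (x - y)D; its positivity selects the positive square
  -- root.
  have hnum : 0 < x * S - y * D := by
    nlinarith [mul_pos (by linarith : 0 < x) (sub_pos.2 hS), mul_pos (by linarith : 0 < x - y) hC]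
  have hr : √(1 + w ^ 2 + s ^ 2) = s * (x * S - y * D) / (2 * ε * D) := by
    rw [Real.sqrt_eq_iff_mul_self_eq_of_pos (by positivity)]
    have h4 : s ^ 2 + 1 = s ^ 2 * c / D := by
      rw [mul_div_assoc, ← hsq]
      field_simp
    have h5 : s ^ 2 * c / D = s ^ 2 * (x ^ 2 - y ^ 2) * (2 * D) / (2 * ε * D) ^ 2 := by
      rw [hc]
      field_simp
    have h6 : 1 + w ^ 2 + s ^ 2 = w ^ 2 + (s ^ 2 + 1) := by ring
    rw [h6, h4, h5, ← hCS, hw]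
    ring
  rw [hr]
  refine Prod.ext ?_ (Prod.ext ?_ ?_) <;> dsimp only
  · rw [hw]
    field_simp
    linear_combination x * hCS
  · rw [hw]
    field_simp
    linear_combination y * hCS
  · have h7 : (S - τ) / s ^ 2 + (S + τ) = 2 * z / ε ^ 2 := by
      rw [← h3]
      linear_combination (S - τ) * hsq
    rw [h7]
    field_simp

/-! ### The inverse mapping -/

/-- The inverse of the exponential mapping on `D₊`. -/
noncomputable def ExpTauInv (ε : ℝ) (q : M) : ℝ × ℝ × ℝ :=
  -- Polar coordinates (w, s) = sinh θ (cos φ, sin φ); on `Dplus`, s > 0 places φ in (0, π), so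
  -- `arccos` recovers it.
  (Real.arsinh √(initialHorizontal ε q ^ 2 + initialVertical ε q ^ 2),
   Real.arccos (initialHorizontal ε q / √(initialHorizontal ε q ^ 2 + initialVertical ε q ^ 2)),
   arrivalTime ε q)

theorem cosh_sq_eq (θ φ : ℝ) : Real.cosh θ ^ 2 =
    1 + (Real.sinh θ * Real.cos φ) ^ 2 + (Real.sinh θ * Real.sin φ) ^ 2 := by
  linear_combination Real.cosh_sq θ - Real.sinh θ ^ 2 * Real.sin_sq_add_cos_sq φ

theorem sinh_mul_sin_pos {ν : ℝ × ℝ × ℝ} (hν : ν ∈ N) :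
    0 < Real.sinh ν.1 * Real.sin ν.2.1 :=
  mul_pos (Real.sinh_pos_iff.2 hν.1) (Real.sin_pos_of_mem_Ioo hν.2.1)

theorem ExpTau_eq_endpoint_of_mem (hε : 0 < ε) {ν : ℝ × ℝ × ℝ} (hν : ν ∈ N) :
    ExpTau hε ν = endpoint ε (Real.cosh ν.1) (Real.sinh ν.1 * Real.cos ν.2.1)
      (Real.sinh ν.1 * Real.sin ν.2.1) ν.2.2 :=
  ExpTau_eq_endpoint hε ν.2.2 (sinh_mul_sin_pos hν).ne'

theorem ExpTau_mem_Dplus (hε : 0 < ε) {ν : ℝ × ℝ × ℝ} (hν : ν ∈ N) : ExpTau hε ν ∈ Dplus ε := by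
  rw [ExpTau_eq_endpoint_of_mem hε hν]
  exact endpoint_mem_Dplus hε (sinh_mul_sin_pos hν) (Real.cosh_pos _) (cosh_sq_eq _ _) hν.2.2

theorem ExpTauInv_ExpTau (hε : 0 < ε) {ν : ℝ × ℝ × ℝ} (hν : ν ∈ N) :
    ExpTauInv ε (ExpTau hε ν) = ν := by
  have hs := sinh_mul_sin_pos hν
  have hθ : 0 < Real.sinh ν.1 := Real.sinh_pos_iff.2 hν.1
  have hh := cosh_sq_eq ν.1 ν.2.1
  have hh0 := Real.cosh_pos ν.1
  have hr : √((Real.sinh ν.1 * Real.cos ν.2.1) ^ 2 + (Real.sinh ν.1 * Real.sin ν.2.1) ^ 2) =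
      Real.sinh ν.1 := by
    rw [← Real.sqrt_sq hθ.le]
    congr 1
    rw [Real.sqrt_sq hθ.le]
    linear_combination Real.sinh ν.1 ^ 2 * Real.sin_sq_add_cos_sq ν.2.1
  rw [ExpTau_eq_endpoint_of_mem hε hν, ExpTauInv, initialHorizontal_endpoint hε hs hh0 hh hν.2.2,
    initialVertical_endpoint hε hs hh0 hh hν.2.2, arrivalTime_endpoint hε hs hh0 hh hν.2.2, hr,
    Real.arsinh_sinh, mul_div_cancel_left₀ _ hθ.ne',
    Real.arccos_cos hν.2.1.1.le hν.2.1.2.le]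

theorem initial_sq_add_sq_pos (hε : 0 < ε) {q : M} (hq : q ∈ Dplus ε) :
    0 < initialHorizontal ε q ^ 2 + initialVertical ε q ^ 2 := by
  have := initialVertical_pos hε hq
  positivity

/-- Strictness comes from s > 0. It keeps φ off 0 and π, and keeps `arccos` where it is smooth. -/
theorem abs_initialHorizontal_div_lt_one (hε : 0 < ε) {q : M} (hq : q ∈ Dplus ε) :
    |initialHorizontal ε q / √(initialHorizontal ε q ^ 2 + initialVertical ε q ^ 2)| < 1 := by
  have hs := initialVertical_pos hε hq
  have hr := Real.sqrt_pos.2 (initial_sq_add_sq_pos hε hq)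
  rw [abs_div, abs_of_pos hr, div_lt_one hr]
  exact Real.lt_sqrt_of_sq_lt (by rw [sq_abs]; linarith [pow_pos hs 2])

theorem ExpTauInv_mem_N (hε : 0 < ε) {q : M} (hq : q ∈ Dplus ε) : ExpTauInv ε q ∈ N := by
  have h := abs_lt.1 (abs_initialHorizontal_div_lt_one hε hq)
  refine ⟨Real.arsinh_pos_iff.2 (Real.sqrt_pos.2 (initial_sq_add_sq_pos hε hq)), ⟨?_, ?_⟩,
    (arrivalTime_spec hε hq).1⟩
  · exact Real.arccos_pos.2 h.2
  · exact lt_of_le_of_ne (Real.arccos_le_pi _) fun e => h.1.not_ge (Real.arccos_eq_pi.1 e)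

theorem ExpTau_ExpTauInv (hε : 0 < ε) {q : M} (hq : q ∈ Dplus ε) :
    ExpTau hε (ExpTauInv ε q) = q := by
  have hs := initialVertical_pos hε hq
  have hr0 := initial_sq_add_sq_pos hε hq
  have hr := Real.sqrt_pos.2 hr0
  have h := abs_lt.1 (abs_initialHorizontal_div_lt_one hε hq)
  have e := endpoint_initial hε hq
  rw [ExpTau_eq_endpoint_of_mem hε (ExpTauInv_mem_N hε hq)]
  have hcos : Real.sinh (ExpTauInv ε q).1 * Real.cos (ExpTauInv ε q).2.1 =
      initialHorizontal ε q := by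
    simp only [ExpTauInv, Real.sinh_arsinh]
    rw [Real.cos_arccos h.1.le h.2.le, mul_div_cancel₀ _ hr.ne']
  have hsin : Real.sinh (ExpTauInv ε q).1 * Real.sin (ExpTauInv ε q).2.1 =
      initialVertical ε q := by
    have h1 : 1 - initialHorizontal ε q ^ 2 /
        (initialHorizontal ε q ^ 2 + initialVertical ε q ^ 2) =
        initialVertical ε q ^ 2 / (initialHorizontal ε q ^ 2 + initialVertical ε q ^ 2) := by
      field_simp
      ring
    simp only [ExpTauInv, Real.sinh_arsinh]
    rw [Real.sin_arccos, div_pow, Real.sq_sqrt hr0.le, h1, Real.sqrt_div (sq_nonneg _),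
      Real.sqrt_sq hs.le, mul_div_cancel₀ _ hr.ne']
  have hcosh : Real.cosh (ExpTauInv ε q).1 =
      √(1 + initialHorizontal ε q ^ 2 + initialVertical ε q ^ 2) := by
    simp only [ExpTauInv, Real.cosh_arsinh, Real.sq_sqrt hr0.le, add_assoc]
  rw [hcos, hsin, hcosh]
  exact e

/-! ### Openness and smoothness -/

theorem isOpen_N : IsOpen N := by
  refine (isOpen_lt continuous_const continuous_fst).inter (IsOpen.inter ?_ ?_)
  · exact isOpen_Ioo.preimage (continuous_fst.comp continuous_snd)
  · exact isOpen_lt continuous_const (continuous_snd.comp continuous_snd)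

theorem contDiff_lorentzSq : ContDiff ℝ ∞ (lorentzSq ε) := by
  unfold lorentzSq
  fun_prop

theorem contDiffAt_arrivalTime (hε : 0 < ε) {q : M} (hq : q ∈ Dplus ε) :
    ContDiffAt ℝ ∞ (arrivalTime ε) q := by
  obtain ⟨h1, h2, h3⟩ := arrivalTime_spec hε hq
  have hc := lorentzSq_pos hε hq.1
  have hh : 0 < 2 * q.2.2 / ε ^ 2 := by
    rw [← h3]
    linarith [two_mul_le_scaledHeight hc.le h1]
  have h4 : ContDiffAt ℝ ∞ (fun q : M => (lorentzSq ε q, 2 * q.2.2 / ε ^ 2)) q :=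
    contDiff_lorentzSq.contDiffAt.prodMk (by fun_prop)
  exact ContDiffAt.comp (g := scaledTime) q (contDiffAt_scaledTime hc hh) h4

theorem contDiffAt_cosh_arrivalTime_sub_one (hε : 0 < ε) {q : M} (hq : q ∈ Dplus ε) :
    ContDiffAt ℝ ∞ (fun q => Real.cosh (arrivalTime ε q) - 1) q :=
  (contDiffAt_arrivalTime hε hq).cosh.sub contDiffAt_const

theorem contDiffAt_initialVertical (hε : 0 < ε) {q : M} (hq : q ∈ Dplus ε) :
    ContDiffAt ℝ ∞ (initialVertical ε) q := by
  have hC := (cosh_sub_one_pos (arrivalTime_spec hε hq).1).ne'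
  have hk := lorentzSq_div_sub_one_pos hε hq
  exact contDiffAt_const.div (((contDiff_lorentzSq.contDiffAt.div
    (contDiffAt_cosh_arrivalTime_sub_one hε hq) hC).sub contDiffAt_const).sqrt hk.ne')
    (Real.sqrt_pos.2 hk).ne'

theorem contDiffAt_initialHorizontal (hε : 0 < ε) {q : M} (hq : q ∈ Dplus ε) :
    ContDiffAt ℝ ∞ (initialHorizontal ε) q := by
  have hC := cosh_sub_one_pos (arrivalTime_spec hε hq).1
  have h1 := contDiffAt_cosh_arrivalTime_sub_one hε hq
  refine ((contDiffAt_initialVertical hε hq).mul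
    ((ContDiffAt.mul (by fun_prop) (contDiffAt_arrivalTime hε hq).sinh).sub
      (contDiffAt_fst.mul h1))).div (contDiffAt_const.mul h1) ?_
  positivity

theorem contDiffAt_ExpTauInv (hε : 0 < ε) {q : M} (hq : q ∈ Dplus ε) :
    ContDiffAt ℝ ∞ (ExpTauInv ε) q := by
  have h := abs_lt.1 (abs_initialHorizontal_div_lt_one hε hq)
  have hr0 := initial_sq_add_sq_pos hε hq
  have hw := contDiffAt_initialHorizontal hε hq
  have hr : ContDiffAt ℝ ∞
      (fun q => √(initialHorizontal ε q ^ 2 + initialVertical ε q ^ 2)) q :=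
    ((hw.pow 2).add ((contDiffAt_initialVertical hε hq).pow 2)).sqrt hr0.ne'
  have hφ := ContDiffAt.comp (g := Real.arccos) q (Real.contDiffAt_arccos h.1.ne' h.2.ne)
    (hw.div hr (Real.sqrt_pos.2 hr0).ne')
  exact hr.arsinh.prodMk (hφ.prodMk (contDiffAt_arrivalTime hε hq))

theorem contDiffOn_ExpTau (hε : 0 < ε) : ContDiffOn ℝ ∞ (ExpTau hε) N := by
  refine ContDiffOn.congr ?_ fun ν hν => ExpTau_eq_endpoint_of_mem hε hν
  intro ν hν
  have hs := (sinh_mul_sin_pos hν).ne'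
  refine ContDiffAt.contDiffWithinAt ?_
  unfold endpoint
  have hS : ContDiffAt ℝ ∞ (fun ν : ℝ × ℝ × ℝ => Real.sinh ν.1 * Real.sin ν.2.1) ν := by fun_prop
  have hk : ContDiffAt ℝ ∞ (fun ν : ℝ × ℝ × ℝ => ε / (Real.sinh ν.1 * Real.sin ν.2.1)) ν :=
    contDiffAt_const.div hS hs
  have hz : ContDiffAt ℝ ∞ (fun ν : ℝ × ℝ × ℝ =>
      (Real.sinh ν.2.2 - ν.2.2) / (Real.sinh ν.1 * Real.sin ν.2.1) ^ 2) ν :=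
    ContDiffAt.div (by fun_prop) (hS.pow 2) (pow_ne_zero 2 hs)
  fun_prop

/-- On the open cone |y| < x the argument of `arcosh` is at least 1, so the upper bound for z is
continuous there; openness is obtained relative to this cone. -/
theorem isOpen_Dplus (hε : 0 < ε) : IsOpen (Dplus ε) := by
  have hU : IsOpen {q : M | |q.2.1| < q.1} := isOpen_lt (by fun_prop) continuous_fst
  have hT : ContinuousOn (fun q : M => Real.arcosh (lorentzSq ε q + 1)) {q : M | |q.2.1| < q.1} :=
    Real.continuousOn_arcosh.comp (contDiff_lorentzSq.continuous.add_const 1).continuousOn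
      fun q hq => by simpa using (lorentzSq_pos hε hq).le
  have hf : ContinuousOn (fun q : M => ε ^ 2 / 2 * (Real.sinh (Real.arcosh (lorentzSq ε q + 1)) +
      Real.arcosh (lorentzSq ε q + 1)) - q.2.2) {q : M | |q.2.1| < q.1} := by fun_prop
  convert! (hf.isOpen_inter_preimage hU (isOpen_Ioi (a := 0))).inter
    (isOpen_lt continuous_const (by fun_prop) : IsOpen {q : M | 0 < q.2.2}) using 1
  ext q
  simp only [Dplus, lorentzSq, mem_ofPred_eq, exists_eq_left, mem_inter_iff, mem_preimage,
    mem_Ioi, sub_pos]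
  tauto

end HeisenbergLorentz

theorem mainTheorem8 (ε : ℝ) (hε : 0 < ε) :
    HeisenbergLorentz.ExpTau hε '' HeisenbergLorentz.N ⊆ HeisenbergLorentz.Dplus ε ∧
    ∃ Φ : OpenPartialHomeomorph (ℝ × ℝ × ℝ) HeisenbergLorentz.M,
      Φ.source = HeisenbergLorentz.N ∧
      Φ.target = HeisenbergLorentz.Dplus ε ∧
      Set.EqOn Φ (HeisenbergLorentz.ExpTau hε) HeisenbergLorentz.N ∧
      ContDiffOn ℝ ∞ Φ HeisenbergLorentz.N ∧
      ContDiffOn ℝ ∞ Φ.symm (HeisenbergLorentz.Dplus ε) := by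
  have hinv : ContDiffOn ℝ ∞ (HeisenbergLorentz.ExpTauInv ε) (HeisenbergLorentz.Dplus ε) :=
    fun q hq => (HeisenbergLorentz.contDiffAt_ExpTauInv hε hq).contDiffWithinAt
  have hexp := HeisenbergLorentz.contDiffOn_ExpTau hε
  refine ⟨image_subset_iff.2 fun ν hν => HeisenbergLorentz.ExpTau_mem_Dplus hε hν,
    { toFun := HeisenbergLorentz.ExpTau hε
      invFun := HeisenbergLorentz.ExpTauInv ε
      source := HeisenbergLorentz.N
      target := HeisenbergLorentz.Dplus ε
      map_source' := fun ν hν => HeisenbergLorentz.ExpTau_mem_Dplus hε hν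
      map_target' := fun q hq => HeisenbergLorentz.ExpTauInv_mem_N hε hq
      left_inv' := fun ν hν => HeisenbergLorentz.ExpTauInv_ExpTau hε hν
      right_inv' := fun q hq => HeisenbergLorentz.ExpTau_ExpTauInv hε hq
      open_source := HeisenbergLorentz.isOpen_N
      open_target := HeisenbergLorentz.isOpen_Dplus hε
      continuousOn_toFun := hexp.continuousOn
      continuousOn_invFun := hinv.continuousOn }, rfl, rfl, fun ν _ => rfl, hexp, hinv⟩
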